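/- Let $n \ge 0$ and write $[n] := \{1,\dots,n\}$. Let $\lambda = (\lambda_1 \ge \dots \ge \lambda_n \ge 0)$ be a partition, and let $q_1 < \dots < q_r$ be the distinct column lengths of its shape that are less than $n$; set $q_0 := 0$ and $q_{r+1} := n$. The intervals $(q_{h-1}, q_h] = \{q_{h-1}+1, \dots, q_h\}$, $1 \le h \le r+1$, are called carrels. Let $\beta = (\beta_1,\dots,\beta_n)$ be an upper $\lambda$-tuple, i.e. $\beta_i \in [n]$ and $\beta_i \ge i$ for all $i \in [n]$. The critical indices of $\beta$ in the carrel $(q_{h-1}, q_h]$ are defined from right to left: the first is $x_1 := q_h$; given $x_{u-1}$, the next is the maximal $x_u$ with $q_{h-1} < x_u < x_{u-1}$ and $\beta_{x_{u-1}} - \beta_{x_u} > x_{u-1} - x_u$, if such an index exists; otherwise the process stops. The $\lambda$-core of $\beta$ is the $n$-tuple $\delta = \Delta_\lambda(\beta)$ with $\delta_i := \beta_x - (x - i)$, where $x = x(i)$ is the smallest critical index with $x \ge i$. The upper $\lambda$-tuple $\beta$ is a gapless core $\lambda$-tuple if for every $1 \le h \le r$ one has $\beta_{q_h} \le \beta_k$,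 where $k$ is the leftmost critical index of $\beta$ in the carrel $(q_h, q_{h+1}]$. Let $s_\lambda(\beta;x) := \sum_T x^{\Theta(T)}$, summed over the semistandard tableaux $T$ of shape $\lambda$ with values in $[n]$ (rows weakly, columns strictly increasing) whose values in row $i$ are at most $\beta_i$ for every $i$; here $x^{\Theta(T)} := \prod_{k=1}^n x_k^{\theta_k}$, where $\theta_k$ is the number of values of $T$ equal to $k$. For $u \in \mathbb{Z}$ and $i, k \in [n]$ let $h_u(i,k;x)$ be the complete homogeneous symmetric polynomial $\sum_{i \le t_1 \le \dots \le t_u \le k} x_{t_1} \cdots x_{t_u}$ in the variables $x_i, \dots, x_k$ if $u \ge 0$, and $h_u(i,k;x) := 0$ if $u < 0$. If $\beta$ is a gapless core $\lambda$-tuple and $\delta = \Delta_\lambda(\beta)$, then $$ s_\lambda(\beta;x) = \det\bigl( h_{\lambda_j - j + i}(i, \delta_j; x) \bigr)_{i,j=1}^n $$ in $\mathbb{Z}[x_1,\dots,x_n]$. (It is not required that $\beta$ be bounded by its platform, i.e. that $\beta_i \le \beta_{x(i)}$ for all $i$.) -/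

import Mathlib

/-! All indices, tuple entries, tableau values and variables are `0`-based: `i : Fin n` stands for
the index, entry, value or variable subscript `i + 1` of `{1, …, n}`. A set `R` of dividers is a set
of natural numbers, `q ∈ R` separating the first `q` indices (those with `i < q`) from the rest. -/

namespace RowBound

/-! ### Tuples with dividers, critical indices, cores -/

section Tuples

variable {n : ℕ}

/-- Upper tuple: every entry is at least its index. -/
def IsUpper (β : Fin n → Fin n) : Prop := ∀ i, i ≤ β i

/-- `x` is the last index of its carrel, i.e. there is a divider directly after it (there is always
one after the last index). -/
def IsCarrelEnd (R : Finset ℕ) (x : Fin n) : Prop := (x : ℕ) + 1 ∈ R ∨ (x : ℕ) + 1 = n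

/-- For `i ≤ j`: no divider stands between `i` and `j`. -/
def SameCarrel (R : Finset ℕ) (i j : Fin n) : Prop := ∀ q ∈ R, ¬ ((i : ℕ) < q ∧ q ≤ (j : ℕ))

/-- `x` lies to the left of `y` in the same carrel, and `β y - β x > y - x`. -/
def Drops (R : Finset ℕ) (β : Fin n → Fin n) (y x : Fin n) : Prop :=
  x < y ∧ SameCarrel R x y ∧ ((y : ℕ) : ℤ) - ((x : ℕ) : ℤ) < ((β y : ℕ) : ℤ) - ((β x : ℕ) : ℤ)

/-- Critical indices: in each carrel the rightmost index is critical, and the next critical index to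
the left of a critical index `y` is the maximal `x` with `Drops R β y x`, if there is one. -/
inductive IsCritical (R : Finset ℕ) (β : Fin n → Fin n) : Fin n → Prop
  | rightmost (x : Fin n) (hx : IsCarrelEnd R x) : IsCritical R β x
  | next (y x : Fin n) (hy : IsCritical R β y) (hx : Drops R β y x)
      (hmax : ∀ z, Drops R β y z → z ≤ x) : IsCritical R β x

open Classical in
/-- The critical indices that are at least `i`. -/
noncomputable def criticalFrom (R : Finset ℕ) (β : Fin n → Fin n) (i : Fin n) : Finset (Fin n) :=
  Finset.univ.filter fun x => i ≤ x ∧ IsCritical R β x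

theorem criticalFrom_nonempty (R : Finset ℕ) (β : Fin n → Fin n) (i : Fin n) :
    (criticalFrom R β i).Nonempty := by
  have hn : 0 < n := i.pos
  refine ⟨⟨n - 1, by omega⟩, ?_⟩
  simp only [criticalFrom, Finset.mem_filter, Finset.mem_univ, true_and]
  refine ⟨?_, IsCritical.rightmost _ (Or.inr ?_)⟩
  · rw [Fin.le_def]
    change (i : ℕ) ≤ n - 1
    omega
  · change n - 1 + 1 = n
    omega

/-- The smallest critical index that is at least `i`; it lies in the carrel of `i`, because the last
index of that carrel is critical. -/
noncomputable def nextCritical (R : Finset ℕ) (β : Fin n → Fin n) (i : Fin n) : Fin n :=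
  (criticalFrom R β i).min' (criticalFrom_nonempty R β i)

/-- The core `Δ_R(β)`: its entry at `i` is `β x - (x - i)`, where `x` is the smallest critical index
that is at least `i`. (For upper `β` the outer subtraction does not truncate.) -/
noncomputable def core (R : Finset ℕ) (β : Fin n → Fin n) (i : Fin n) : Fin n :=
  ⟨(β (nextCritical R β i) : ℕ) - ((nextCritical R β i : ℕ) - (i : ℕ)),
    lt_of_le_of_lt (Nat.sub_le _ _) (β (nextCritical R β i)).isLt⟩

/-- The critical list of `β` is a flag critical list: if the index `i` ends a carrel and `j = i + 1`
starts the next one, then the entry at `i` is at most the leftmost critical entry of the next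
carrel. -/
def HasFlagCriticalList (R : Finset ℕ) (β : Fin n → Fin n) : Prop :=
  ∀ i j : Fin n, (i : ℕ) + 1 = (j : ℕ) → (j : ℕ) ∈ R → β i ≤ β (nextCritical R β j)

/-- Gapless core `R`-tuple: an upper tuple whose critical list is a flag critical list. -/
def IsGaplessCore (R : Finset ℕ) (β : Fin n → Fin n) : Prop :=
  IsUpper β ∧ HasFlagCriticalList R β

end Tuples

/-! ### Shapes, tableaux, polynomials -/

section Shapes

variable {n : ℕ}

/-- The shape with rows of lengths `lam 0 ≥ … ≥ lam (n - 1) ≥ 0`. -/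
def shape (lam : Fin n → ℕ) (hlam : Antitone lam) : YoungDiagram :=
  YoungDiagram.ofRowLens (List.ofFn lam) hlam.sortedGE_ofFn

theorem mem_shape (lam : Fin n → ℕ) (hlam : Antitone lam) (i j : ℕ) :
    (i, j) ∈ shape lam hlam ↔ ∃ h : i < n, j < lam ⟨i, h⟩ := by
  simp [shape, YoungDiagram.mem_ofRowLens]

/-- `R_λ`: the set of the column lengths of the shape that are less than `n`. -/
def columnLengths (lam : Fin n → ℕ) (hlam : Antitone lam) : Finset ℕ :=
  ((Finset.range ((shape lam hlam).rowLen 0)).image (shape lam hlam).colLen).filter (· < n)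

/-- The semistandard tableaux of the given shape with values among the `n` allowed ones whose values
in row `i` are at most `β i`. -/
def rowBoundSet (lam : Fin n → ℕ) (hlam : Antitone lam) (β : Fin n → Fin n) :
    Set (SemistandardYoungTableau (shape lam hlam)) :=
  {T | (∀ i j : ℕ, (i, j) ∈ shape lam hlam → T i j < n) ∧
    ∀ (i : Fin n) (j : ℕ), ((i : ℕ), j) ∈ shape lam hlam → T i j ≤ (β i : ℕ)}

theorem rowBoundSet_finite (lam : Fin n → ℕ) (hlam : Antitone lam) (β : Fin n → Fin n) :
    (rowBoundSet lam hlam β).Finite := by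
  let f : rowBoundSet lam hlam β → ((shape lam hlam).cells → Fin n) :=
    fun T c => ⟨T.1 c.1.1 c.1.2, T.2.1 _ _ ((shape lam hlam).mem_cells _ |>.1 c.2)⟩
  have hf : Function.Injective f := by
    intro S T h
    apply Subtype.ext
    apply SemistandardYoungTableau.ext
    intro i j
    by_cases hij : (i, j) ∈ shape lam hlam
    · have := congrFun h ⟨(i, j), (shape lam hlam).mem_cells _ |>.2 hij⟩
      exact congrArg Fin.val this
    · rw [S.1.zeros hij, T.1.zeros hij]
  exact Set.finite_coe_iff.mp (Finite.of_injective f hf)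

/-- The monomial `x ^ Θ(T)`: the exponent of `x k` is the number of boxes of `T` with value `k`. -/
noncomputable def tableauMonomial {μ : YoungDiagram} (n : ℕ) (T : SemistandardYoungTableau μ) :
    MvPolynomial (Fin n) ℤ :=
  ∏ k : Fin n, MvPolynomial.X k ^ (μ.cells.filter fun c => T c.1 c.2 = (k : ℕ)).card

/-- The row bound sum `s_λ(β; x)`. -/
noncomputable def rowBoundSum (lam : Fin n → ℕ) (hlam : Antitone lam) (β : Fin n → Fin n) :
    MvPolynomial (Fin n) ℤ :=
  ∑ T ∈ (rowBoundSet_finite lam hlam β).toFinset, tableauMonomial n T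

/-- `h_u(i, k; x)`: the complete homogeneous symmetric polynomial of degree `u` in the variables
`x i, …, x k`, and `0` for `u < 0`. -/
noncomputable def completeHomogeneous (u : ℤ) (i k : Fin n) : MvPolynomial (Fin n) ℤ :=
  if u < 0 then 0
  else ∑ s ∈ (Finset.Icc i k).sym u.toNat,
    ((s : Multiset (Fin n)).map fun t => MvPolynomial.X t).prod

end Shapes

end RowBound

/-! Removing the boxes with the largest value from a semistandard tableau leaves a tableau whose
shape interlaces with the old one; the determinants `det (h_{λ_j - j + i}(1, φ_j))` satisfy the
same recursion by multilinearity in the columns, so for a weakly increasing flag `φ` they compute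
the tableau sum. Two changes turn this into the determinant of the theorem.

Flag: in a carrel the rows have equal lengths, so the strict increase along columns makes the row
bounds `β` and their platform (constant between critical indices) equivalent, and the platform is
weakly increasing because `β` is a gapless core tuple. If column `j` of the determinant has
generating series `t^(j - λ_j) / ∏_{k ≤ φ_j} (1 - x_k t)`, then lowering the platform entry at `j`
to the core entry multiplies it by a polynomial in `t` with constant term `1`, of degree at most
the distance from `j` to the next critical index. Between these two indices the columns are shifts
of column `j`, so this is a unitriangular column operation.

Variables: multiplying row `i` by `∏_{k < i} (1 - x_k t)` removes the variables before `x_i`, and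
is a unitriangular row operation. -/

namespace RowBound

/-! ### Generating series of complete homogeneous symmetric polynomials -/

section Series

open LaurentSeries Polynomial

variable {A : Type*} [CommRing A] {ι : Type*}

/-- The monomial `t ^ u`. Laurent series are used so that series can be shifted, and their
coefficients taken, at arbitrary integers. -/
noncomputable abbrev tPow (u : ℤ) : A⸨X⸩ := HahnSeries.single u 1

theorem tPow_mul_tPow (u v : ℤ) : (tPow u * tPow v : A⸨X⸩) = tPow (u + v) := by
  rw [HahnSeries.single_mul_single, one_mul]

theorem coeff_tPow_mul (u v : ℤ) (F : A⸨X⸩) : (tPow u * F).coeff v = F.coeff (v - u) := by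
  rw [HahnSeries.coeff_single_mul, one_mul]

/-- A polynomial in `t`, as a Laurent series. -/
noncomputable def polySeries : A[X] →+* A⸨X⸩ :=
  (HahnSeries.ofPowerSeries ℤ A).comp coeToPowerSeries.ringHom

theorem polySeries_C_mul_X_pow (a : A) (k : ℕ) :
    polySeries (C a * X ^ k) = HahnSeries.single (k : ℤ) a := by
  simp [polySeries]

theorem polySeries_eq_sum (P : A[X]) {d : ℕ} (hd : P.natDegree < d) :
    polySeries P = ∑ k ∈ Finset.range d, HahnSeries.single (k : ℤ) (P.coeff k) := by
  conv_lhs => rw [P.as_sum_range_C_mul_X_pow' hd]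
  simp only [map_sum, polySeries_C_mul_X_pow]

theorem coeff_polySeries_of_natDegree_lt (P : A[X]) {u : ℤ} (hu : P.natDegree < u) :
    (polySeries P).coeff u = 0 := by
  lift u to ℕ using (Nat.cast_nonneg _).trans hu.le
  simpa [polySeries] using coeff_eq_zero_of_natDegree_lt (Nat.cast_lt.mp hu)

theorem coeff_polySeries_mul (P : A[X]) {d : ℕ} (hd : P.natDegree < d) (F : A⸨X⸩) (u : ℤ) :
    (polySeries P * F).coeff u = ∑ k ∈ Finset.range d, P.coeff k * F.coeff (u - k) := by
  simp only [polySeries_eq_sum P hd, Finset.sum_mul, HahnSeries.coeff_sum,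
    HahnSeries.coeff_single_mul]

/-- The geometric series `1 + a t + a ^ 2 t ^ 2 + …`. -/
noncomputable def geomSeries (a : A) : A⸨X⸩ :=
  HahnSeries.ofPowerSeries ℤ A (PowerSeries.mk (a ^ ·))

theorem one_sub_single_mul_geomSeries (a : A) : (1 - HahnSeries.single 1 a) * geomSeries a = 1 := by
  have h : (1 - PowerSeries.C a * PowerSeries.X) * PowerSeries.mk (a ^ ·) = 1 := by
    have h := congrArg (PowerSeries.rescale a) (PowerSeries.mk_one_mul_one_sub_eq_one A)
    simpa [PowerSeries.rescale_mk, PowerSeries.rescale_X, mul_comm] using h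
  simpa [geomSeries] using congrArg (HahnSeries.ofPowerSeries ℤ A) h

/-- The generating series of the complete homogeneous symmetric polynomials in the `x l`,
`l ∈ s`. -/
noncomputable def homSeries (x : ι → A) (s : Finset ι) : A⸨X⸩ := ∏ l ∈ s, geomSeries (x l)

/-- The inverse of `homSeries x s`, i.e. the generating polynomial of the elementary symmetric
polynomials with alternating signs. -/
noncomputable def elemPoly (x : ι → A) (s : Finset ι) : A[X] := ∏ l ∈ s, (1 - C (x l) * X)

theorem homSeries_empty (x : ι → A) : homSeries x ∅ = 1 := Finset.prod_empty

theorem elemPoly_coeff_zero (x : ι → A) (s : Finset ι) : (elemPoly x s).coeff 0 = 1 := by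
  simp [elemPoly, coeff_zero_prod]

theorem elemPoly_natDegree_le (x : ι → A) (s : Finset ι) : (elemPoly x s).natDegree ≤ s.card := by
  refine (natDegree_prod_le _ _).trans ((Finset.sum_le_card_nsmul _ _ 1 fun l _ => ?_).trans ?_)
  · compute_degree
  · simp

theorem polySeries_elemPoly_mul_homSeries (x : ι → A) (s : Finset ι) :
    polySeries (elemPoly x s) * homSeries x s = 1 := by
  rw [elemPoly, map_prod, homSeries, ← Finset.prod_mul_distrib]
  refine Finset.prod_eq_one fun l _ => ?_
  rw [map_sub, map_one, ← pow_one X, polySeries_C_mul_X_pow]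
  exact one_sub_single_mul_geomSeries (x l)

theorem polySeries_elemPoly_sdiff_mul_homSeries [DecidableEq ι] (x : ι → A) {s t : Finset ι}
    (hst : s ⊆ t) : polySeries (elemPoly x (t \ s)) * homSeries x t = homSeries x s := by
  have h : homSeries x (t \ s) * homSeries x s = homSeries x t := Finset.prod_sdiff hst
  rw [← h, ← mul_assoc, polySeries_elemPoly_mul_homSeries, one_mul]

theorem polySeries_elemPoly_mul_homSeries_of_subset [DecidableEq ι] (x : ι → A) {s t : Finset ι}
    (hst : s ⊆ t) :
    polySeries (elemPoly x t) * homSeries x s = polySeries (elemPoly x (t \ s)) := by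
  have h : elemPoly x (t \ s) * elemPoly x s = elemPoly x t := Finset.prod_sdiff hst
  rw [← h, map_mul, mul_assoc, polySeries_elemPoly_mul_homSeries, mul_one]

theorem homSeries_eq_one_sub_mul_insert [DecidableEq ι] (x : ι → A) {s : Finset ι} {a : ι}
    (ha : a ∉ s) :
    homSeries x s = (1 - HahnSeries.single 1 (x a)) * homSeries x (insert a s) := by
  rw [homSeries, homSeries, Finset.prod_insert ha, ← mul_assoc, one_sub_single_mul_geomSeries,
    one_mul]

theorem homSeries_eq_ofPowerSeries (x : ι → A) (s : Finset ι) :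
    homSeries x s = HahnSeries.ofPowerSeries ℤ A (∏ l ∈ s, PowerSeries.mk (x l ^ ·)) :=
  (map_prod _ _ _).symm

theorem coeff_homSeries_of_neg (x : ι → A) (s : Finset ι) {u : ℤ} (hu : u < 0) :
    (homSeries x s).coeff u = 0 := by
  rw [homSeries_eq_ofPowerSeries, PowerSeries.coeff_coe, if_pos hu]

theorem coeff_prod_mk_pow [DecidableEq ι] (x : ι → A) (s : Finset ι) (m : ℕ) :
    PowerSeries.coeff m (∏ l ∈ s, PowerSeries.mk (x l ^ ·)) =
      ∑ p ∈ s.sym m, ((p : Multiset ι).map x).prod := by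
  induction s using Finset.induction_on generalizing m with
  | empty =>
    cases m with
    | zero =>
      rw [Finset.prod_empty, PowerSeries.coeff_zero_one, Finset.sym_zero, Finset.sum_singleton]
      exact Multiset.prod_zero.symm
    | succ m => simp [PowerSeries.coeff_one]
  | insert a s ha ih =>
    rw [Finset.prod_insert ha, PowerSeries.coeff_mul,
      Finset.Nat.sum_antidiagonal_eq_sum_range_succ_mk, ← Finset.sum_coe_sort ((insert a s).sym m),
      ← (Finset.symInsertEquiv ha).symm.sum_comp, Fintype.sum_sigma, Finset.sum_range]
    refine Finset.sum_congr rfl fun i _ => ?_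
    rw [ih, PowerSeries.coeff_mk, Finset.mul_sum, ← Finset.sum_coe_sort (s.sym (m - i))]
    refine Finset.sum_congr rfl fun p _ => ?_
    have h : (((Finset.symInsertEquiv ha).symm ⟨i, p⟩ : (insert a s).sym m) : Sym ι m) =
      p.1.fill a i := rfl
    rw [h, Sym.coe_fill, Multiset.map_add, Multiset.prod_add, Sym.coe_replicate,
      Multiset.map_replicate, Multiset.prod_replicate, mul_comm]

theorem coeff_homSeries [DecidableEq ι] (x : ι → A) (s : Finset ι) (m : ℕ) :
    (homSeries x s).coeff m = ∑ p ∈ s.sym m, ((p : Multiset ι).map x).prod := by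
  rw [homSeries_eq_ofPowerSeries, HahnSeries.ofPowerSeries_apply_coeff, coeff_prod_mk_pow]

theorem completeHomogeneous_eq_coeff_homSeries {n : ℕ} (u : ℤ) (i k : Fin n) :
    completeHomogeneous u i k = (homSeries MvPolynomial.X (Finset.Icc i k)).coeff u := by
  rw [completeHomogeneous]
  split_ifs with hu
  · rw [coeff_homSeries_of_neg _ _ hu]
  · lift u to ℕ using not_lt.mp hu
    rw [coeff_homSeries, Int.toNat_natCast]

/-- The variables of `MvPolynomial (Fin n) ℤ`, continued by `0` to all natural numbers. -/
noncomputable def natVar (n : ℕ) : ℕ → MvPolynomial (Fin n) ℤ :=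
  Function.extend Fin.val MvPolynomial.X 0

theorem natVar_val {n : ℕ} (k : Fin n) : natVar n k = MvPolynomial.X k :=
  Fin.val_injective.extend_apply _ _ k

theorem homSeries_natVar {n : ℕ} (i k : Fin n) :
    homSeries (natVar n) (Finset.Ico (i : ℕ) (k + 1)) =
      homSeries MvPolynomial.X (Finset.Icc i k) := by
  have h : Finset.Ico (i : ℕ) (k + 1) = (Finset.Icc i k).map Fin.valEmbedding := by
    rw [Fin.map_valEmbedding_Icc]
    rfl
  simp only [homSeries, h, Finset.prod_map, Fin.valEmbedding_apply, natVar_val]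

end Series

/-! ### Determinants of coefficients of Laurent series -/

section CoeffDet

open LaurentSeries Polynomial

variable {A : Type*} [CommRing A] {n : ℕ}

/-- The determinant of the matrix whose `j`-th column lists the coefficients of `1, t, …, t ^ (n-1)`
in `F j`. -/
noncomputable def coeffDet (F : Fin n → A⸨X⸩) : A :=
  Matrix.det (Matrix.of fun i j : Fin n => (F j).coeff (i : ℕ))

theorem coeffDet_congr {F G : Fin n → A⸨X⸩}
    (h : ∀ i j : Fin n, (F j).coeff (i : ℕ) = (G j).coeff (i : ℕ)) : coeffDet F = coeffDet G := by
  simp only [coeffDet, h]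

theorem coeffDet_sum {κ : Type*} (s : Fin n → Finset κ) (c : Fin n → κ → A)
    (F : Fin n → κ → A⸨X⸩) :
    coeffDet (fun j => ∑ m ∈ s j, HahnSeries.C (c j m) * F j m) =
      ∑ μ ∈ Fintype.piFinset s, (∏ j, c j (μ j)) * coeffDet fun j => F j (μ j) := by
  classical
  let D := (Matrix.detRowAlternating (R := A) (n := Fin n)).toMultilinearMap
  have hD (G : Fin n → A⸨X⸩) : coeffDet G = D fun j i => (G j).coeff (i : ℕ) :=
    (Matrix.det_transpose _).symm
  calc coeffDet (fun j => ∑ m ∈ s j, HahnSeries.C (c j m) * F j m)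
      = D fun j => ∑ m ∈ s j, c j m • fun i : Fin n => (F j m).coeff (i : ℕ) := by
        rw [hD]
        congr 1
        funext j i
        simp [HahnSeries.coeff_sum, HahnSeries.C_apply]
    _ = _ := by
        rw [D.map_sum_finset]
        refine Finset.sum_congr rfl fun μ _ => ?_
        rw [D.map_smul_univ, smul_eq_mul, hD]

theorem coeffDet_sum_unitriangular (U : Fin n → Fin n → A) (hU : ∀ l j, l < j → U l j = 0)
    (hU' : ∀ j, U j j = 1) (F : Fin n → A⸨X⸩) :
    coeffDet (fun j => ∑ l, HahnSeries.C (U l j) * F l) = coeffDet F := by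
  have hdet : (Matrix.of U).det = 1 := by
    rw [Matrix.det_of_isLowerTriangular (Matrix.of U) fun l j hlj => hU l j hlj]
    exact Finset.prod_eq_one fun j _ => hU' j
  rw [coeffDet, coeffDet, ← mul_one (Matrix.det (Matrix.of fun i j => (F j).coeff _)), ← hdet,
    ← Matrix.det_mul]
  congr 1
  ext i j
  simp [Matrix.mul_apply, HahnSeries.coeff_sum, HahnSeries.C_apply, mul_comm]

/-- The entry after the `j`-th one of a tuple, and `0` after the last one. -/
def nextEntry {α : Type*} [Zero α] (f : Fin n → α) (j : Fin n) : α :=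
  if h : (j : ℕ) + 1 < n then f ⟨j + 1, h⟩ else 0

theorem coeffDet_sub_nextEntry (c : Fin n → A) (F : Fin n → A⸨X⸩) :
    coeffDet (fun j => F j - HahnSeries.C (c j) * nextEntry F j) = coeffDet F := by
  let U (l j : Fin n) : A := if l = j then 1 else if (l : ℕ) = j + 1 then -c j else 0
  rw [← coeffDet_sum_unitriangular U (fun l j h => by grind) (fun j => if_pos rfl) F]
  congr 1
  funext j
  have hU (l : Fin n) : HahnSeries.C (U l j) * F l = (if l = j then F l else 0) -
      if (l : ℕ) = j + 1 then HahnSeries.C (c j) * F l else 0 := by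
    grind
  simp only [hU, Finset.sum_sub_distrib, Finset.sum_ite_eq', Finset.mem_univ, if_true]
  congr 1
  by_cases h : (j : ℕ) + 1 < n
  · rw [Finset.sum_eq_single ⟨j + 1, h⟩ (by grind) (by simp)]
    simp [nextEntry, h]
  · rw [Finset.sum_eq_zero (by grind)]
    simp [nextEntry, h]

theorem coeffDet_polySeries_mul (P : Fin n → A[X]) (hP : ∀ j, (P j).coeff 0 = 1)
    (hdeg : ∀ j, j + (P j).natDegree < n) (F : Fin n → A⸨X⸩)
    (hF : ∀ j l : Fin n, j ≤ l → (l : ℕ) ≤ j + (P j).natDegree →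
      F l = tPow ((l : ℤ) - j) * F j) :
    coeffDet (fun j => polySeries (P j) * F j) = coeffDet F := by
  have hU (l j : Fin n) : (X ^ (j : ℕ) * P j).coeff l =
      if (j : ℕ) ≤ l then (P j).coeff (l - j) else 0 := coeff_X_pow_mul' ..
  rw [← coeffDet_sum_unitriangular (fun l j => (X ^ (j : ℕ) * P j).coeff l) (by grind) (by grind) F]
  congr 1
  funext j
  have hshift : tPow (-j) * polySeries (X ^ (j : ℕ) * P j) = polySeries (P j) := by
    have hX : polySeries (X ^ (j : ℕ) : A[X]) = tPow j := by
      simpa using polySeries_C_mul_X_pow (1 : A) j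
    rw [map_mul, hX, ← mul_assoc, tPow_mul_tPow, neg_add_cancel]
    exact one_mul _
  have hdeg' : (X ^ (j : ℕ) * P j).natDegree < n := by
    have := natDegree_X_pow_le (R := A) (j : ℕ)
    have := natDegree_mul_le (p := X ^ (j : ℕ)) (q := P j)
    have := hdeg j
    omega
  rw [← hshift, polySeries_eq_sum _ hdeg', Finset.sum_range, Finset.mul_sum, Finset.sum_mul]
  refine Finset.sum_congr rfl fun l _ => ?_
  by_cases hl : j ≤ l ∧ (l : ℕ) ≤ j + (P j).natDegree
  · rw [hF j l hl.1 hl.2, ← mul_assoc, HahnSeries.C_apply, HahnSeries.single_mul_single,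
      HahnSeries.single_mul_single, one_mul, mul_one, zero_add, neg_add_eq_sub]
  · have hcoeff : (X ^ (j : ℕ) * P j).coeff l = 0 := by
      grind [coeff_eq_zero_of_natDegree_lt]
    rw [hcoeff]
    simp

theorem det_coeff_polySeries_mul (P : Fin n → A[X]) (hP : ∀ i, (P i).coeff 0 = 1)
    (hdeg : ∀ i, (P i).natDegree ≤ i) (F : Fin n → A⸨X⸩) :
    Matrix.det (Matrix.of fun i j : Fin n => (polySeries (P i) * F j).coeff (i : ℕ)) =
      coeffDet F := by
  let U (i k : Fin n) : A := if k ≤ i then (P i).coeff (i - k) else 0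
  have hdet : (Matrix.of U).det = 1 := by
    rw [Matrix.det_of_isLowerTriangular (Matrix.of U) fun i k hik => if_neg (not_le.mpr hik)]
    exact Finset.prod_eq_one fun i _ => by simp [U, hP]
  rw [coeffDet, ← one_mul (Matrix.det (Matrix.of fun i j => (F j).coeff _)), ← hdet,
    ← Matrix.det_mul]
  congr 1
  ext i j
  calc (polySeries (P i) * F j).coeff (i : ℕ)
      = ∑ k ∈ Finset.range (i + 1), (P i).coeff k * (F j).coeff ((i - k : ℕ) : ℤ) := by
        rw [coeff_polySeries_mul _ (Nat.lt_succ_of_le (hdeg i))]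
        refine Finset.sum_congr rfl fun k hk => ?_
        rw [Nat.cast_sub (Finset.mem_range_succ_iff.mp hk)]
    _ = ∑ k ∈ Finset.range (i + 1), (P i).coeff (i - k) * (F j).coeff (k : ℤ) := by
        rw [← Finset.sum_flip]
        refine Finset.sum_congr rfl fun k hk => ?_
        rw [Nat.sub_sub_self (Finset.mem_range_succ_iff.mp hk)]
    _ = ∑ k ∈ Finset.range n, if k ≤ i then (P i).coeff (i - k) * (F j).coeff (k : ℤ) else 0 := by
        rw [← Finset.sum_filter]
        refine Finset.sum_congr ?_ fun _ _ => rfl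
        ext k
        simp only [Finset.mem_filter, Finset.mem_range]
        omega
    _ = ∑ k, U i k * (F j).coeff (k : ℕ) := by
        rw [Finset.sum_range]
        simp only [U, Fin.le_def, ite_mul, zero_mul]
    _ = _ := by rw [Matrix.mul_apply]; rfl

end CoeffDet

/-! ### Flagged determinants and their expansion along horizontal strips -/

section FlagSeries

open LaurentSeries

variable {A : Type*} [CommRing A] {n : ℕ}

/-- The `j`-th column of the flagged Jacobi–Trudi matrix, as a series: its coefficient of `t ^ i` is
the complete homogeneous symmetric polynomial of degree `lam j - j + i` in the first `φ j`
variables. -/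
noncomputable def flagSeries (x : ℕ → A) (φ lam : Fin n → ℕ) (j : Fin n) : A⸨X⸩ :=
  tPow ((j : ℤ) - lam j) * homSeries x (Finset.range (φ j))

theorem coeffDet_flagSeries_zero (x : ℕ → A) (lam : Fin n → ℕ) :
    coeffDet (flagSeries x 0 lam) = if lam = 0 then 1 else 0 := by
  have hcoeff (i j : Fin n) : (flagSeries x 0 lam j).coeff (i : ℕ) =
      if (i : ℤ) + lam j = j then 1 else 0 := by
    simp only [flagSeries, coeff_tPow_mul, Pi.zero_apply, Finset.range_zero, homSeries_empty,
      HahnSeries.coeff_one]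
    congr 1
    grind
  rw [coeffDet, Matrix.det_of_isUpperTriangular]
  · simp only [Matrix.of_apply, hcoeff, Finset.prod_ite_zero, Finset.prod_const_one]
    congr 1
    simp [funext_iff]
  · intro i j hji
    rw [Matrix.of_apply, hcoeff, if_neg (by grind)]

theorem homSeries_range_eq_mul (x : ℕ → A) (N : ℕ) :
    homSeries x (Finset.range N) =
      (1 - HahnSeries.C (x N) * tPow 1) * homSeries x (Finset.range (N + 1)) := by
  rw [Finset.range_add_one, homSeries_eq_one_sub_mul_insert x Finset.notMem_range_self,
    HahnSeries.C_apply, HahnSeries.single_mul_single, zero_add, mul_one]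

theorem sum_Icc_tPow_mul_homSeries (x : ℕ → A) (N : ℕ) (c : ℤ) {a b : ℕ} (hab : a ≤ b) :
    ∑ m ∈ Finset.Icc a b, HahnSeries.C (x N ^ (b - m)) *
        (tPow (c - m) * homSeries x (Finset.range N)) =
      tPow (c - b) * homSeries x (Finset.range (N + 1)) - HahnSeries.C (x N ^ (b + 1 - a)) *
        (tPow (c + 1 - a) * homSeries x (Finset.range (N + 1))) := by
  have hterm (m : ℕ) : tPow (c - m) * homSeries x (Finset.range N) =
      tPow (c - m) * homSeries x (Finset.range (N + 1)) -
        HahnSeries.C (x N) * (tPow (c + 1 - m) * homSeries x (Finset.range (N + 1))) := by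
    have h : (tPow (c + 1 - m) : A⸨X⸩) = tPow (c - m) * tPow 1 := by
      rw [tPow_mul_tPow, sub_add_eq_add_sub]
    rw [homSeries_range_eq_mul, h]
    ring
  induction b, hab using Nat.le_induction with
  | base => simp [hterm]
  | succ b hab ih =>
    have hpow (m : ℕ) (hm : m ∈ Finset.Icc a b) :
        x N ^ (b + 1 - m) = x N * x N ^ (b - m) := by
      rw [Nat.succ_sub (Finset.mem_Icc.mp hm).2, pow_succ']
    rw [Finset.sum_Icc_succ_top (by omega), Finset.sum_congr rfl fun m hm => by
      rw [hpow m hm, map_mul, mul_assoc], ← Finset.mul_sum, ih, hterm (b + 1),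
      Nat.succ_sub (by omega : a ≤ b + 1), pow_succ' (x N)]
    have h : c + 1 - ((b + 1 : ℕ) : ℤ) = c - b := by grind
    rw [h, Nat.sub_self, pow_zero, map_one, one_mul, map_mul]
    ring

/-- The possible lengths of row `j` after the removal, from a shape with row lengths `lam`, of a
horizontal strip of boxes with value `N` in the rows with flag more than `N`. -/
def stripParts (φ lam : Fin n → ℕ) (N : ℕ) (j : Fin n) : Finset ℕ :=
  if N < φ j then Finset.Icc (nextEntry lam j) (lam j) else {lam j}

theorem nextEntry_le {lam : Fin n → ℕ} (hlam : Antitone lam) (j : Fin n) :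
    nextEntry lam j ≤ lam j := by
  rw [nextEntry]
  split_ifs
  · exact hlam (Fin.le_def.mpr (Nat.le_succ _))
  · exact Nat.zero_le _

theorem sum_stripParts_eq_sub (x : ℕ → A) {φ lam : Fin n → ℕ} (hφ : Monotone φ)
    (hlam : Antitone lam) {N : ℕ} (hN : ∀ j, φ j ≤ N + 1) (i j : Fin n) :
    (∑ m ∈ stripParts φ lam N j, HahnSeries.C (x N ^ (lam j - m)) *
      (tPow ((j : ℤ) - m) * homSeries x (Finset.range (min (φ j) N)))).coeff (i : ℕ) =
    (flagSeries x φ lam j -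
      HahnSeries.C (if N < φ j then x N ^ (lam j + 1 - nextEntry lam j) else 0) *
        nextEntry (flagSeries x φ lam) j).coeff (i : ℕ) := by
  by_cases hj : N < φ j
  · have hφj : φ j = N + 1 := (hN j).antisymm hj
    rw [stripParts, if_pos hj, if_pos hj, min_eq_right hj.le,
      sum_Icc_tPow_mul_homSeries x N j (nextEntry_le hlam j), flagSeries, hφj]
    by_cases hjn : (j : ℕ) + 1 < n
    · have hφj' : φ ⟨j + 1, hjn⟩ = N + 1 :=
        (hN _).antisymm (hj.trans_le (hφ (Fin.le_def.mpr (Nat.le_succ _))))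
      simp [nextEntry, hjn, flagSeries, hφj']
    · have hzero : (tPow ((j : ℤ) + 1) * homSeries x (Finset.range (N + 1))).coeff (i : ℕ) = 0 := by
        rw [coeff_tPow_mul, coeff_homSeries_of_neg _ _ (by grind)]
      simp [nextEntry, hjn, HahnSeries.C_apply, hzero]
  · simp [stripParts, hj, flagSeries, min_eq_left (not_lt.mp hj)]

theorem coeffDet_flagSeries_succ (x : ℕ → A) {φ lam : Fin n → ℕ} (hφ : Monotone φ)
    (hlam : Antitone lam) {N : ℕ} (hN : ∀ j, φ j ≤ N + 1) :
    coeffDet (flagSeries x φ lam) = ∑ μ ∈ Fintype.piFinset (stripParts φ lam N),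
      (∏ j, x N ^ (lam j - μ j)) * coeffDet (flagSeries x (fun j => min (φ j) N) μ) := by
  rw [← coeffDet_sub_nextEntry fun j => if N < φ j then x N ^ (lam j + 1 - nextEntry lam j) else 0]
  refine (coeffDet_congr fun i j => (sum_stripParts_eq_sub x hφ hlam hN i j).symm).trans ?_
  exact coeffDet_sum _ _ fun (j : Fin n) (m : ℕ) =>
    tPow ((j : ℤ) - m) * homSeries x (Finset.range (min (φ j) N))

end FlagSeries

section Strips

variable {n : ℕ} {φ lam μ : Fin n → ℕ} {N : ℕ}

theorem mem_piFinset_stripParts (hlam : Antitone lam) :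
    μ ∈ Fintype.piFinset (stripParts φ lam N) ↔
      ∀ j, nextEntry lam j ≤ μ j ∧ μ j ≤ lam j ∧ (φ j ≤ N → μ j = lam j) := by
  rw [Fintype.mem_piFinset]
  refine forall_congr' fun j => ?_
  have := nextEntry_le hlam j
  grind [stripParts]

theorem le_nextEntry (hlam : Antitone lam) {i j : Fin n} (hij : i < j) :
    lam j ≤ nextEntry lam i := by
  have hi : (i : ℕ) + 1 < n := (Nat.succ_le_of_lt hij).trans_lt j.isLt
  rw [nextEntry, dif_pos hi]
  exact hlam (Nat.succ_le_of_lt hij)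

theorem le_of_mem_stripParts (hlam : Antitone lam)
    (hμ : μ ∈ Fintype.piFinset (stripParts φ lam N)) {i j : Fin n} (hij : i < j) :
    lam j ≤ μ i :=
  (le_nextEntry hlam hij).trans ((mem_piFinset_stripParts hlam).mp hμ i).1

theorem antitone_of_mem_stripParts (hlam : Antitone lam)
    (hμ : μ ∈ Fintype.piFinset (stripParts φ lam N)) : Antitone μ := by
  intro i j hij
  rcases hij.eq_or_lt with rfl | h
  · exact le_rfl
  · exact ((mem_piFinset_stripParts hlam).mp hμ j).2.1.trans (le_of_mem_stripParts hlam hμ h)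

end Strips

/-! ### Flagged tableaux -/

section FlagTableaux

variable {n : ℕ}

/-- `T` is a semistandard filling of rows of lengths `lam i` with values less than `φ i` in row `i`,
continued by `0` outside the rows. -/
structure IsFlagTableau (φ lam : Fin n → ℕ) (T : Fin n → ℕ → ℕ) : Prop where
  zeros : ∀ i j, lam i ≤ j → T i j = 0
  lt_flag : ∀ i j, j < lam i → T i j < φ i
  row_weak : ∀ i j j', j ≤ j' → j' < lam i → T i j ≤ T i j'
  col_strict : ∀ i i' j, i < i' → j < lam i' → T i j < T i' j

theorem finite_setOf_isFlagTableau (φ lam : Fin n → ℕ) : {T | IsFlagTableau φ lam T}.Finite := by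
  let f (T : {T | IsFlagTableau φ lam T}) (i : Fin n) (j : Fin (lam i)) : Fin (φ i) :=
    ⟨T.1 i j, T.2.lt_flag i j j.2⟩
  refine Set.finite_coe_iff.mp (Finite.of_injective f fun S T h => Subtype.ext ?_)
  funext i j
  by_cases hj : j < lam i
  · exact congrArg Fin.val (congrFun (congrFun h i) ⟨j, hj⟩)
  · rw [S.2.zeros i j (not_lt.mp hj), T.2.zeros i j (not_lt.mp hj)]

/-- The finite set of the semistandard fillings with row lengths `lam` and flag `φ`. -/
noncomputable def flagTableaux (φ lam : Fin n → ℕ) : Finset (Fin n → ℕ → ℕ) :=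
  (finite_setOf_isFlagTableau φ lam).toFinset

theorem mem_flagTableaux {φ lam : Fin n → ℕ} {T : Fin n → ℕ → ℕ} :
    T ∈ flagTableaux φ lam ↔ IsFlagTableau φ lam T :=
  Set.Finite.mem_toFinset _

/-- The flagged Schur polynomial: the sum of the monomials of the fillings in
`flagTableaux φ lam`. -/
noncomputable def flagSum {A : Type*} [CommSemiring A] (x : ℕ → A) (φ lam : Fin n → ℕ) : A :=
  ∑ T ∈ flagTableaux φ lam, ∏ i, ∏ j ∈ Finset.range (lam i), x (T i j)

theorem flagTableaux_zero (lam : Fin n → ℕ) :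
    flagTableaux 0 lam = if lam = 0 then {0} else ∅ := by
  ext T
  rw [mem_flagTableaux]
  split_ifs with h
  · rw [Finset.mem_singleton]
    refine ⟨fun hT => funext₂ fun i j => hT.zeros i j (h ▸ Nat.zero_le j), ?_⟩
    rintro rfl
    constructor <;> simp [h]
  · obtain ⟨i, hi⟩ := Function.ne_iff.mp h
    exact iff_of_false (fun hT => Nat.not_lt_zero _ (hT.lt_flag i 0 (Nat.pos_of_ne_zero hi)))
      (Finset.notMem_empty T)

theorem flagSum_zero {A : Type*} [CommSemiring A] (x : ℕ → A) (lam : Fin n → ℕ) :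
    flagSum x 0 lam = if lam = 0 then 1 else 0 := by
  rw [flagSum, flagTableaux_zero]
  split_ifs with h <;> simp [h]

theorem lt_count_iff {p : ℕ → Prop} [DecidablePred p] {b : ℕ}
    (hp : ∀ j k, j ≤ k → k < b → p k → p j) {j : ℕ} : j < Nat.count p b ↔ j < b ∧ p j := by
  constructor
  · intro hj
    have hjb : j < b := hj.trans_le (Nat.count_le _)
    refine ⟨hjb, by_contra fun hpj => hj.not_ge ?_⟩
    have hzero : Nat.count (fun k => p (j + k)) (b - j) = 0 :=
      Nat.count_of_forall_not fun k hk hpk => hpj (hp j (j + k) (by omega) (by omega) hpk)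
    rw [← Nat.add_sub_cancel' hjb.le, Nat.count_add, hzero]
    exact Nat.count_le _
  · rintro ⟨hjb, hpj⟩
    rw [← Nat.succ_le_iff, ← Nat.count_of_forall fun k hk =>
      hp k j (Nat.lt_succ_iff.mp hk) hjb hpj]
    exact Nat.count_monotone p hjb

/-- The number of boxes in row `i` with values less than `N`. -/
def partBelow (lam : Fin n → ℕ) (N : ℕ) (T : Fin n → ℕ → ℕ) (i : Fin n) : ℕ :=
  Nat.count (T i · < N) (lam i)

/-- The filling with only the boxes in rows of lengths `μ i` kept. -/
def restrictRows (μ : Fin n → ℕ) (T : Fin n → ℕ → ℕ) (i : Fin n) (j : ℕ) : ℕ :=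
  if j < μ i then T i j else 0

/-- The filling whose rows are extended from lengths `μ i` to lengths `lam i` by boxes of value
`N`. -/
def extendRows (lam μ : Fin n → ℕ) (N : ℕ) (U : Fin n → ℕ → ℕ) (i : Fin n) (j : ℕ) : ℕ :=
  if j < μ i then U i j else if j < lam i then N else 0

variable {φ lam μ : Fin n → ℕ} {N : ℕ} {T U : Fin n → ℕ → ℕ}

theorem partBelow_le (i : Fin n) : partBelow lam N T i ≤ lam i :=
  Nat.count_le _

theorem IsFlagTableau.lt_partBelow_iff (hT : IsFlagTableau φ lam T) {i : Fin n} {j : ℕ} :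
    j < partBelow lam N T i ↔ j < lam i ∧ T i j < N :=
  lt_count_iff fun j k hjk hk => (hT.row_weak i j k hjk hk).trans_lt

theorem IsFlagTableau.partBelow_mem_stripParts (hT : IsFlagTableau φ lam T) (hlam : Antitone lam)
    (hN : ∀ i, φ i ≤ N + 1) : partBelow lam N T ∈ Fintype.piFinset (stripParts φ lam N) := by
  rw [mem_piFinset_stripParts hlam]
  intro i
  refine ⟨?_, partBelow_le i, fun hi => (partBelow_le i).antisymm ?_⟩
  · by_contra! hlt
    rw [nextEntry] at hlt
    split_ifs at hlt with hin
    · have hi : i < ⟨i + 1, hin⟩ := Nat.lt_succ_self _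
      have hstrict := hT.col_strict i _ _ hi hlt
      have hflag := hT.lt_flag _ _ hlt
      have hbox := (hT.lt_partBelow_iff (N := N)).mpr
        ⟨hlt.trans_le (hlam hi.le), hstrict.trans_le (Nat.le_of_lt_succ (hflag.trans_le (hN _)))⟩
      exact hbox.false
    · exact Nat.not_lt_zero _ hlt
  · by_contra! hlt
    exact (hT.lt_partBelow_iff.mpr ⟨hlt, (hT.lt_flag i _ hlt).trans_le hi⟩).false

theorem isFlagTableau_restrictRows (hT : IsFlagTableau φ lam T)
    (hanti : Antitone (partBelow lam N T)) :
    IsFlagTableau (fun i => min (φ i) N) (partBelow lam N T)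
      (restrictRows (partBelow lam N T) T) := by
  have hbox (i : Fin n) (j : ℕ) (hj : j < partBelow lam N T i) : j < lam i ∧ T i j < N :=
    hT.lt_partBelow_iff.mp hj
  refine ⟨fun i j hj => if_neg hj.not_gt, fun i j hj => ?_, fun i j j' hjj' hj' => ?_,
    fun i i' j hii' hj => ?_⟩
  · rw [restrictRows, if_pos hj]
    exact lt_min (hT.lt_flag i j (hbox i j hj).1) (hbox i j hj).2
  · rw [restrictRows, restrictRows, if_pos (hjj'.trans_lt hj'), if_pos hj']
    exact hT.row_weak i j j' hjj' (hbox i j' hj').1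
  · rw [restrictRows, restrictRows, if_pos (hj.trans_le (hanti hii'.le)), if_pos hj]
    exact hT.col_strict i i' j hii' (hbox i' j hj).1

theorem isFlagTableau_extendRows (hlam : Antitone lam)
    (hμ : μ ∈ Fintype.piFinset (stripParts φ lam N))
    (hU : IsFlagTableau (fun i => min (φ i) N) μ U) :
    IsFlagTableau φ lam (extendRows lam μ N U) := by
  have hstrip := (mem_piFinset_stripParts hlam).mp hμ
  have hval (i : Fin n) (j : ℕ) (hj : j < μ i) : U i j < φ i ∧ U i j < N :=
    lt_min_iff.mp (hU.lt_flag i j hj)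
  refine ⟨fun i j hj => ?_, fun i j hj => ?_, fun i j j' hjj' hj' => ?_, fun i i' j hii' hj => ?_⟩
  · grind [extendRows]
  · grind [extendRows]
  · have hweak := hU.row_weak i j j' hjj'
    have hvalj := hval i j
    grind [extendRows]
  · have hji : j < μ i := hj.trans_le (le_of_mem_stripParts hlam hμ hii')
    have hcol := hU.col_strict i i' j hii'
    have hvalj := hval i j hji
    grind [extendRows]

theorem IsFlagTableau.partBelow_extendRows (hlam : Antitone lam)
    (hμ : μ ∈ Fintype.piFinset (stripParts φ lam N))
    (hU : IsFlagTableau (fun i => min (φ i) N) μ U) :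
    partBelow lam N (extendRows lam μ N U) = μ := by
  funext i
  have hle := ((mem_piFinset_stripParts hlam).mp hμ i).2.1
  refine eq_of_forall_lt_iff fun j => ?_
  have hval (hj : j < μ i) : U i j < N := (lt_min_iff.mp (hU.lt_flag i j hj)).2
  rw [(isFlagTableau_extendRows hlam hμ hU).lt_partBelow_iff]
  grind [extendRows]

theorem IsFlagTableau.restrictRows_extendRows (hU : IsFlagTableau φ μ U) :
    restrictRows μ (extendRows lam μ N U) = U := by
  funext i j
  grind [extendRows, restrictRows, hU.zeros]

theorem IsFlagTableau.extendRows_restrictRows (hT : IsFlagTableau φ lam T)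
    (hN : ∀ i, φ i ≤ N + 1) :
    extendRows lam (partBelow lam N T) N (restrictRows (partBelow lam N T) T) = T := by
  funext i j
  have hflag := hT.lt_flag i j
  have hbox := hT.lt_partBelow_iff (N := N) (i := i) (j := j)
  grind [extendRows, restrictRows, hT.zeros]

theorem prod_extendRows {A : Type*} [CommMonoid A] (x : ℕ → A) (hle : μ ≤ lam) :
    ∏ i, ∏ j ∈ Finset.range (lam i), x (extendRows lam μ N U i j) =
      (∏ i, x N ^ (lam i - μ i)) * ∏ i, ∏ j ∈ Finset.range (μ i), x (U i j) := by
  rw [← Finset.prod_mul_distrib]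
  refine Finset.prod_congr rfl fun i _ => ?_
  have hstrip : ∏ j ∈ Finset.Ico (μ i) (lam i), x (extendRows lam μ N U i j) =
      x N ^ (lam i - μ i) := by
    rw [← Nat.card_Ico, ← Finset.prod_const]
    exact Finset.prod_congr rfl (by grind [extendRows])
  rw [← Finset.prod_range_mul_prod_Ico _ (hle i), hstrip, mul_comm]
  congr 1
  exact Finset.prod_congr rfl (by grind [extendRows])

theorem flagSum_succ {A : Type*} [CommSemiring A] (x : ℕ → A) (hlam : Antitone lam)
    (hN : ∀ i, φ i ≤ N + 1) :
    flagSum x φ lam = ∑ μ ∈ Fintype.piFinset (stripParts φ lam N),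
      (∏ i, x N ^ (lam i - μ i)) * flagSum x (fun i => min (φ i) N) μ := by
  rw [flagSum, ← Finset.sum_fiberwise_of_maps_to fun T hT =>
    (mem_flagTableaux.mp hT).partBelow_mem_stripParts hlam hN]
  refine Finset.sum_congr rfl fun μ hμ => ?_
  rw [flagSum, Finset.mul_sum]
  refine Finset.sum_nbij' (restrictRows μ) (extendRows lam μ N) ?_ ?_ ?_ ?_ ?_ <;>
    simp only [Finset.mem_filter, mem_flagTableaux]
  · rintro T ⟨hT, rfl⟩
    exact isFlagTableau_restrictRows hT (antitone_of_mem_stripParts hlam hμ)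
  · exact fun U hU => ⟨isFlagTableau_extendRows hlam hμ hU, hU.partBelow_extendRows hlam hμ⟩
  · rintro T ⟨hT, rfl⟩
    exact hT.extendRows_restrictRows hN
  · exact fun U hU => hU.restrictRows_extendRows
  · rintro T ⟨hT, rfl⟩
    rw [← prod_extendRows x partBelow_le, hT.extendRows_restrictRows hN]

theorem flagSum_eq_coeffDet {A : Type*} [CommRing A] (x : ℕ → A) (hφ : Monotone φ)
    (hlam : Antitone lam) : flagSum x φ lam = coeffDet (flagSeries x φ lam) := by
  obtain ⟨N, hN⟩ : ∃ N, ∀ i, φ i ≤ N := Finite.exists_le φ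
  induction N generalizing φ lam with
  | zero =>
    obtain rfl : φ = 0 := funext fun i => Nat.le_zero.mp (hN i)
    rw [flagSum_zero, coeffDet_flagSeries_zero]
  | succ N ih =>
    rw [flagSum_succ x hlam hN, coeffDet_flagSeries_succ x hφ hlam hN]
    refine Finset.sum_congr rfl fun μ hμ => ?_
    rw [ih (fun i j hij => min_le_min_right N (hφ hij)) (antitone_of_mem_stripParts hlam hμ)
      fun i => min_le_right _ _]

end FlagTableaux

/-! ### Critical indices -/

section Critical

variable {n : ℕ} {R : Finset ℕ} {β : Fin n → Fin n}

theorem mem_criticalFrom {i x : Fin n} : x ∈ criticalFrom R β i ↔ i ≤ x ∧ IsCritical R β x := by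
  simp [criticalFrom]

theorem le_nextCritical (i : Fin n) : i ≤ nextCritical R β i :=
  (mem_criticalFrom.mp (Finset.min'_mem _ (criticalFrom_nonempty R β i))).1

theorem isCritical_nextCritical (i : Fin n) : IsCritical R β (nextCritical R β i) :=
  (mem_criticalFrom.mp (Finset.min'_mem _ (criticalFrom_nonempty R β i))).2

theorem nextCritical_le {i x : Fin n} (hix : i ≤ x) (hx : IsCritical R β x) :
    nextCritical R β i ≤ x :=
  Finset.min'_le _ _ (mem_criticalFrom.mpr ⟨hix, hx⟩)

theorem IsCritical.nextCritical_eq {x : Fin n} (hx : IsCritical R β x) :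
    nextCritical R β x = x :=
  (nextCritical_le le_rfl hx).antisymm (le_nextCritical x)

theorem nextCritical_eq_of_le {i j : Fin n} (hij : i ≤ j) (hj : j ≤ nextCritical R β i) :
    nextCritical R β j = nextCritical R β i :=
  (nextCritical_le hj (isCritical_nextCritical i)).antisymm
    (nextCritical_le (hij.trans (le_nextCritical j)) (isCritical_nextCritical j))

theorem SameCarrel.mono {i i' j j' : Fin n} (h : SameCarrel R i j) (hi : i ≤ i') (hj : j' ≤ j) :
    SameCarrel R i' j' :=
  fun q hq hlt => h q hq ⟨by omega, by omega⟩

theorem sameCarrel_nextCritical (i : Fin n) : SameCarrel R i (nextCritical R β i) := by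
  rintro (_ | x) hq ⟨hiq, hqx⟩
  · exact Nat.not_lt_zero _ hiq
  · have hxn : x < n := (Nat.lt_of_succ_le hqx).trans (nextCritical R β i).isLt
    exact (nextCritical_le (x := ⟨x, hxn⟩) (Nat.le_of_lt_succ hiq)
      (.rightmost _ (Or.inl hq))).not_gt hqx

theorem IsCritical.exists_next {x y : Fin n} (hy : IsCritical R β y) (hx : Drops R β y x) :
    ∃ z, x ≤ z ∧ z < y ∧ IsCritical R β z := by
  classical
  let s := Finset.univ.filter (Drops R β y)
  have hs : s.Nonempty := ⟨x, Finset.mem_filter_univ x |>.mpr hx⟩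
  have hmax (z : Fin n) (hz : Drops R β y z) : z ≤ s.max' hs :=
    s.le_max' z (Finset.mem_filter_univ z |>.mpr hz)
  have hdrop : Drops R β y (s.max' hs) := (Finset.mem_filter_univ _).mp (s.max'_mem hs)
  exact ⟨s.max' hs, hmax x hx, hdrop.1, .next y _ hy hdrop hmax⟩

theorem entry_nextCritical_le (i : Fin n) :
    (β (nextCritical R β i) : ℕ) ≤ β i + (nextCritical R β i - i) := by
  have hle := le_nextCritical (R := R) (β := β) i
  by_contra! hgt
  have hlt : i < nextCritical R β i := hle.lt_of_ne fun h => by grind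
  have hdrop : Drops R β (nextCritical R β i) i := ⟨hlt, sameCarrel_nextCritical i, by omega⟩
  obtain ⟨z, hiz, hz, hcrit⟩ := (isCritical_nextCritical i).exists_next hdrop
  exact (nextCritical_le hiz hcrit).not_gt hz

/-- The platform of `β`: the entry at `i` is the entry of `β` at the smallest critical index that is
at least `i`. -/
noncomputable def platform (R : Finset ℕ) (β : Fin n → Fin n) (i : Fin n) : Fin n :=
  β (nextCritical R β i)

theorem IsCritical.entry_le_entry_nextCritical (hβ : HasFlagCriticalList R β) {i j : Fin n}
    (hi : IsCritical R β i) (hij : (i : ℕ) + 1 = j) : β i ≤ β (nextCritical R β j) := by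
  cases hi with
  | rightmost _ hend =>
    exact hβ i j hij (hij ▸ hend.resolve_right (hij ▸ j.isLt.ne))
  | next y _ hy hdrop hmax =>
    obtain ⟨hiy, hcarrel, hlt⟩ := hdrop
    have hjz := le_nextCritical (R := R) (β := β) j
    have hzy : nextCritical R β j ≤ y := nextCritical_le (by omega) hy
    have hiz : i < nextCritical R β j := by omega
    -- `Drops` fails strictly between `i` and `y`: going down from `y` to an index there lowers `β`
    -- by at most the distance.
    have hnot : ¬ Drops R β y (nextCritical R β j) := fun h => (hmax _ h).not_gt hiz
    rcases hzy.eq_or_lt with hz | hz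
    · rw [hz]
      omega
    · have hgap := not_lt.mp fun h => hnot ⟨hz, hcarrel.mono hiz.le le_rfl, h⟩
      omega

theorem monotone_platform (hβ : HasFlagCriticalList R β) : Monotone (platform R β) := by
  refine (monotone_iff_forall_covBy _).mpr fun i j hij => ?_
  have hij' : (i : ℕ) + 1 = j := by simpa using hij
  rw [platform, platform]
  rcases (le_nextCritical i).eq_or_lt with hi | hi
  · rw [← hi]
    exact (hi ▸ isCritical_nextCritical i : IsCritical R β i).entry_le_entry_nextCritical hβ hij'
  · rw [nextCritical_eq_of_le hij.le (by omega)]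

end Critical

/-! ### Row bound sums -/

section RowBoundSums

variable {n : ℕ} {lam : Fin n → ℕ} {hlam : Antitone lam}

theorem eq_of_sameCarrel {R : Finset ℕ} (hR : columnLengths lam hlam ⊆ R) {i j : Fin n}
    (hij : i ≤ j) (h : SameCarrel R i j) : lam j = lam i := by
  refine (hlam hij).antisymm (le_of_not_gt fun hlt => ?_)
  have hi : ((i : ℕ), lam j) ∈ shape lam hlam := (mem_shape _ _ _ _).mpr ⟨i.isLt, hlt⟩
  have hj : ((j : ℕ), lam j) ∉ shape lam hlam := by simp [mem_shape]
  have h0 : (0, lam j) ∈ shape lam hlam := (shape lam hlam).up_left_mem i.val.zero_le le_rfl hi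
  rw [YoungDiagram.mem_iff_lt_colLen] at hi hj
  rw [YoungDiagram.mem_iff_lt_rowLen] at h0
  exact h _ (hR (Finset.mem_filter.mpr ⟨Finset.mem_image_of_mem _ (Finset.mem_range.mpr h0),
    (not_lt.mp hj).trans_lt j.isLt⟩)) ⟨hi, not_lt.mp hj⟩

theorem mem_rowBoundSet_iff {ψ : Fin n → Fin n} {T : SemistandardYoungTableau (shape lam hlam)} :
    T ∈ rowBoundSet lam hlam ψ ↔
      IsFlagTableau (fun i => (ψ i : ℕ) + 1) lam fun i j => T i j := by
  have hmem (i : Fin n) (j : ℕ) : ((i : ℕ), j) ∈ shape lam hlam ↔ j < lam i := by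
    simp [mem_shape]
  constructor
  · rintro ⟨-, hbound⟩
    refine ⟨fun i j hj => T.zeros (mt (hmem i j).mp hj.not_gt),
      fun i j hj => Nat.lt_succ_of_le (hbound i j ((hmem i j).mpr hj)),
      fun i j j' hjj' hj' => ?_, fun i i' j hii' hj => ?_⟩
    · exact T.row_weak_of_le hjj' ((hmem i j').mpr hj')
    · exact T.col_strict hii' ((hmem i' j).mpr hj)
  · intro hT
    have hbound (i : Fin n) (j : ℕ) (hij : ((i : ℕ), j) ∈ shape lam hlam) : T i j ≤ ψ i :=
      Nat.le_of_lt_succ (hT.lt_flag i j ((hmem i j).mp hij))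
    refine ⟨fun i j hij => ?_, hbound⟩
    obtain ⟨hi, -⟩ := (mem_shape _ _ _ _).mp hij
    exact (hbound ⟨i, hi⟩ j hij).trans_lt (ψ ⟨i, hi⟩).isLt

/-- A semistandard filling with row lengths `lam`, as a tableau of Mathlib. -/
def IsFlagTableau.toTableau {φ : Fin n → ℕ} {T : Fin n → ℕ → ℕ} (hT : IsFlagTableau φ lam T) :
    SemistandardYoungTableau (shape lam hlam) where
  entry i j := if h : i < n then T ⟨i, h⟩ j else 0
  row_weak' := by
    intro i j j' hjj' hmem
    obtain ⟨hi, hj⟩ := (mem_shape _ _ _ _).mp hmem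
    simpa only [hi, dite_true] using hT.row_weak _ _ _ hjj'.le hj
  col_strict' := by
    intro i i' j hii' hmem
    obtain ⟨hi', hj⟩ := (mem_shape _ _ _ _).mp hmem
    simpa only [hi', hii'.trans hi', dite_true] using hT.col_strict ⟨i, _⟩ ⟨i', hi'⟩ _ hii' hj
  zeros' := by
    intro i j hmem
    split_ifs with hi
    · exact hT.zeros _ _ (not_lt.mp fun hj => hmem ((mem_shape _ _ _ _).mpr ⟨hi, hj⟩))
    · rfl

theorem IsFlagTableau.toTableau_apply {φ : Fin n → ℕ} {T : Fin n → ℕ → ℕ}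
    (hT : IsFlagTableau φ lam T) (i : Fin n) (j : ℕ) :
    (hT.toTableau : SemistandardYoungTableau (shape lam hlam)) i j = T i j :=
  dif_pos i.isLt

theorem prod_cells_shape {M : Type*} [CommMonoid M] (f : ℕ → ℕ → M) :
    ∏ c ∈ (shape lam hlam).cells, f c.1 c.2 = ∏ i : Fin n, ∏ j ∈ Finset.range (lam i), f i j := by
  rw [Finset.prod_sigma']
  symm
  refine Finset.prod_nbij (fun c => ((c.1 : ℕ), c.2)) ?_ ?_ ?_ fun _ _ => rfl
  · rintro ⟨i, j⟩ h
    simpa [mem_shape] using h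
  · rintro ⟨i, j⟩ _ ⟨i', j'⟩ _ h
    simpa [Fin.ext_iff] using h
  · rintro ⟨i, j⟩ h
    obtain ⟨hi, hj⟩ := (mem_shape _ _ _ _).mp ((YoungDiagram.mem_cells _).mp h)
    exact ⟨⟨⟨i, hi⟩, j⟩, by simpa using hj, rfl⟩

theorem tableauMonomial_eq_prod {T : SemistandardYoungTableau (shape lam hlam)}
    (hT : ∀ i j : ℕ, (i, j) ∈ shape lam hlam → T i j < n) :
    tableauMonomial n T = ∏ i : Fin n, ∏ j ∈ Finset.range (lam i), natVar n (T i j) := by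
  simp_rw [← prod_cells_shape (hlam := hlam) fun i j => natVar n (T i j), tableauMonomial,
    ← Finset.prod_const, Finset.prod_filter]
  rw [Finset.prod_comm]
  refine Finset.prod_congr rfl fun c hc => ?_
  obtain ⟨k, hk⟩ : ∃ k : Fin n, (k : ℕ) = T c.1 c.2 :=
    ⟨⟨T c.1 c.2, hT c.1 c.2 ((YoungDiagram.mem_cells _).mp hc)⟩, rfl⟩
  simp [← hk, natVar_val, Fin.val_inj]

theorem rowBoundSum_eq_flagSum (ψ : Fin n → Fin n) :
    rowBoundSum lam hlam ψ = flagSum (natVar n) (fun i => (ψ i : ℕ) + 1) lam := by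
  have hmem {T} : T ∈ (rowBoundSet_finite lam hlam ψ).toFinset ↔ T ∈ rowBoundSet lam hlam ψ :=
    Set.Finite.mem_toFinset _
  refine Finset.sum_nbij (fun T i j => T i j) (fun T hT => ?_) (fun S _ T _ h => ?_)
    (fun T hT => ?_) fun T hT => tableauMonomial_eq_prod (hmem.mp hT).1
  · exact mem_flagTableaux.mpr (mem_rowBoundSet_iff.mp (hmem.mp hT))
  · refine SemistandardYoungTableau.ext fun i j => ?_
    by_cases hij : (i, j) ∈ shape lam hlam
    · exact congrFun₂ h ⟨i, ((mem_shape _ _ _ _).mp hij).1⟩ j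
    · rw [S.zeros hij, T.zeros hij]
  · have hflag := mem_flagTableaux.mp hT
    have hentry : (fun (i : Fin n) j => hflag.toTableau (hlam := hlam) i j) = T :=
      funext₂ hflag.toTableau_apply
    exact ⟨hflag.toTableau, hmem.mpr (mem_rowBoundSet_iff.mpr (hentry.symm ▸ hflag)), hentry⟩

theorem IsFlagTableau.add_sub_le {φ : Fin n → ℕ} {T : Fin n → ℕ → ℕ} (hT : IsFlagTableau φ lam T)
    (hlam : Antitone lam) {i i' : Fin n} (hii' : i ≤ i') {j : ℕ} (hj : j < lam i') :
    T i j + (i' - i) ≤ T i' j := by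
  obtain ⟨i', hi'⟩ := i'
  replace hii' : (i : ℕ) ≤ i' := hii'
  induction i', hii' using Nat.le_induction with
  | base => simp
  | succ k hik ih =>
    have hk : (⟨k, by omega⟩ : Fin n) < ⟨k + 1, hi'⟩ := Nat.lt_succ_self k
    have hle := ih _ (hj.trans_le (hlam hk.le))
    have hlt := hT.col_strict _ _ j hk hj
    simp only at hle ⊢
    omega

/-- Within a block of equal row lengths, the columns force the values to drop by at least one per
row going up, so that the flag of a lower row also bounds the rows above it. -/
theorem IsFlagTableau.of_flag_le {φ ψ : Fin n → ℕ} {T : Fin n → ℕ → ℕ}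
    (hT : IsFlagTableau φ lam T) (hlam : Antitone lam)
    (hφψ : ∀ i, ∃ i' ≥ i, lam i' = lam i ∧ φ i' ≤ ψ i + (i' - i)) : IsFlagTableau ψ lam T where
  __ := hT
  lt_flag i j hj := by
    obtain ⟨i', hii', heq, hle⟩ := hφψ i
    have hj' : j < lam i' := heq ▸ hj
    have hcol := hT.add_sub_le hlam hii' hj'
    have hflag := hT.lt_flag i' j hj'
    omega

theorem rowBoundSum_platform {R : Finset ℕ} (hR : columnLengths lam hlam ⊆ R)
    (β : Fin n → Fin n) : rowBoundSum lam hlam (platform R β) = rowBoundSum lam hlam β := by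
  have hblock (i : Fin n) : lam (nextCritical R β i) = lam i :=
    eq_of_sameCarrel hR (le_nextCritical i) (sameCarrel_nextCritical i)
  refine Finset.sum_congr ?_ fun _ _ => rfl
  ext T
  simp only [Set.Finite.mem_toFinset, mem_rowBoundSet_iff]
  refine ⟨fun hT => hT.of_flag_le hlam fun i => ?_, fun hT => hT.of_flag_le hlam fun i => ?_⟩
  · refine ⟨_, le_nextCritical i, hblock i, ?_⟩
    have hle := entry_nextCritical_le (R := R) (β := β) i
    rw [platform, (isCritical_nextCritical i).nextCritical_eq]
    omega
  · exact ⟨_, le_nextCritical i, hblock i, Nat.le_add_right _ _⟩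

end RowBoundSums

/-! ### The determinant formula -/

section FlagDeterminants

open Polynomial LaurentSeries

variable {A : Type*} [CommRing A] {n : ℕ}

theorem coeffDet_flagSeries_of_staircase (x : ℕ → A) {lam φ δ : Fin n → ℕ} (hδφ : δ ≤ φ)
    (hn : ∀ j, j + (φ j - δ j) < n)
    (hstair : ∀ j l : Fin n, j ≤ l → (l : ℕ) ≤ j + (φ j - δ j) → φ l = φ j ∧ lam l = lam j) :
    coeffDet (flagSeries x δ lam) = coeffDet (flagSeries x φ lam) := by
  let P (j : Fin n) : A[X] := elemPoly x (Finset.range (φ j) \ Finset.range (δ j))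
  have hdeg (j : Fin n) : (P j).natDegree ≤ φ j - δ j :=
    (elemPoly_natDegree_le x _).trans_eq <| by
      rw [Finset.card_sdiff_of_subset (Finset.range_mono (hδφ j)), Finset.card_range,
        Finset.card_range]
  have hδ : flagSeries x δ lam = fun j => polySeries (P j) * flagSeries x φ lam j := by
    funext j
    rw [flagSeries, flagSeries, mul_left_comm,
      polySeries_elemPoly_sdiff_mul_homSeries x (Finset.range_mono (hδφ j))]
  rw [hδ]
  refine coeffDet_polySeries_mul P (fun j => elemPoly_coeff_zero _ _)
    (fun j => (Nat.add_le_add_left (hdeg j) j).trans_lt (hn j)) _ fun j l hjl hl => ?_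
  obtain ⟨hφ, hlam⟩ := hstair j l hjl (hl.trans (Nat.add_le_add_left (hdeg j) j))
  rw [flagSeries, flagSeries, hφ, hlam, ← mul_assoc, tPow_mul_tPow, sub_add_sub_cancel]

theorem coeff_polySeries_mul_homSeries_range (x : ℕ → A) (i b : ℕ) {u : ℤ} (hu : (i : ℤ) - b < u) :
    (polySeries (elemPoly x (Finset.range i)) * homSeries x (Finset.range b)).coeff u =
      (homSeries x (Finset.Ico i b)).coeff u := by
  rcases le_total i b with hib | hbi
  · have h : Finset.range i = Finset.range b \ Finset.Ico i b := by grind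
    rw [h, polySeries_elemPoly_sdiff_mul_homSeries x (by grind)]
  · have hdeg : (elemPoly x (Finset.range i \ Finset.range b)).natDegree ≤ i - b :=
      (elemPoly_natDegree_le x _).trans_eq <| by
        rw [Finset.card_sdiff_of_subset (Finset.range_mono hbi), Finset.card_range,
          Finset.card_range]
    rw [polySeries_elemPoly_mul_homSeries_of_subset x (Finset.range_mono hbi),
      coeff_polySeries_of_natDegree_lt _ (by omega), Finset.Ico_eq_empty_of_le hbi, homSeries_empty,
      HahnSeries.coeff_one, if_neg (by omega)]

theorem coeffDet_flagSeries_eq_det (x : ℕ → A) {φ : Fin n → ℕ} (hφ : ∀ j : Fin n, (j : ℕ) < φ j)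
    (lam : Fin n → ℕ) :
    coeffDet (flagSeries x φ lam) = Matrix.det (Matrix.of fun i j : Fin n =>
      (homSeries x (Finset.Ico (i : ℕ) (φ j))).coeff ((lam j : ℤ) - (j : ℕ) + (i : ℕ))) := by
  rw [← det_coeff_polySeries_mul (fun i => elemPoly x (Finset.range i))
    (fun i => elemPoly_coeff_zero _ _)
    fun i => (elemPoly_natDegree_le x _).trans_eq (Finset.card_range i)]
  congr 2
  funext i j
  have hj := hφ j
  have hu : (i : ℤ) - ((j : ℤ) - lam j) = (lam j : ℤ) - (j : ℕ) + (i : ℕ) := by ring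
  rw [flagSeries, mul_left_comm, coeff_tPow_mul, hu,
    coeff_polySeries_mul_homSeries_range x i (φ j) (by omega)]

end FlagDeterminants

section GaplessCore

variable {n : ℕ} {R : Finset ℕ} {β : Fin n → Fin n}

theorem core_add_eq (hβ : IsUpper β) (i : Fin n) :
    (core R β i : ℕ) + (nextCritical R β i - i) = platform R β i := by
  have hle := le_nextCritical (R := R) (β := β) i
  have hupper := hβ (nextCritical R β i)
  simp only [core, platform]
  omega

theorem le_core (hβ : IsUpper β) (i : Fin n) : i ≤ core R β i := by
  have hle := le_nextCritical (R := R) (β := β) i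
  have hupper := hβ (nextCritical R β i)
  have hcore := core_add_eq (R := R) hβ i
  rw [platform] at hcore
  omega

theorem coeffDet_flagSeries_core {A : Type*} [CommRing A] (x : ℕ → A) {lam : Fin n → ℕ}
    {hlam : Antitone lam} (hR : columnLengths lam hlam ⊆ R) (hβ : IsUpper β) :
    coeffDet (flagSeries x (fun i => (core R β i : ℕ) + 1) lam) =
      coeffDet (flagSeries x (fun i => (platform R β i : ℕ) + 1) lam) := by
  have hdiff (i : Fin n) :
      (i : ℕ) + ((platform R β i : ℕ) + 1 - (core R β i + 1)) = nextCritical R β i := by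
    have hle := le_nextCritical (R := R) (β := β) i
    have hcore := core_add_eq (R := R) hβ i
    omega
  refine coeffDet_flagSeries_of_staircase x (fun i => ?_)
    (fun i => (hdiff i).trans_lt (nextCritical R β i).isLt) fun i l hil hl => ?_
  · exact Nat.succ_le_succ ((Nat.le_add_right _ _).trans_eq (core_add_eq hβ i))
  · replace hl : l ≤ nextCritical R β i := hl.trans_eq (hdiff i)
    exact ⟨by rw [platform, platform, nextCritical_eq_of_le hil hl],
      eq_of_sameCarrel hR hil ((sameCarrel_nextCritical i).mono le_rfl hl)⟩

end GaplessCore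

end RowBound

open RowBound in
theorem corollary5p3_general {n : ℕ} {lam : Fin n → ℕ} {hlam : Antitone lam} {R : Finset ℕ}
    (hR : columnLengths lam hlam ⊆ R) {β : Fin n → Fin n} (hβ : IsGaplessCore R β) :
    rowBoundSum lam hlam β =
      Matrix.det (Matrix.of fun i j : Fin n =>
        completeHomogeneous ((lam j : ℤ) - (j : ℕ) + (i : ℕ)) i (core R β j)) := by
  have hplatform : Monotone fun i => (platform R β i : ℕ) + 1 := fun i j hij =>
    Nat.succ_le_succ (monotone_platform hβ.2 hij)
  calc rowBoundSum lam hlam β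
      = flagSum (natVar n) (fun i => (platform R β i : ℕ) + 1) lam := by
        rw [← rowBoundSum_platform hR, rowBoundSum_eq_flagSum]
    _ = coeffDet (flagSeries (natVar n) (fun i => (core R β i : ℕ) + 1) lam) := by
        rw [flagSum_eq_coeffDet _ hplatform hlam, coeffDet_flagSeries_core _ hR hβ.1]
    _ = _ := by
        rw [coeffDet_flagSeries_eq_det _ fun j => Nat.lt_succ_of_le (le_core hβ.1 j)]
        simp only [homSeries_natVar, completeHomogeneous_eq_coeff_homSeries]

theorem corollary5p3 (n : ℕ) (lam : Fin n → ℕ) (hlam : Antitone lam) (β : Fin n → Fin n)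
    (hβ : RowBound.IsGaplessCore (RowBound.columnLengths lam hlam) β) :
    RowBound.rowBoundSum lam hlam β =
      Matrix.det (Matrix.of fun i j : Fin n =>
        RowBound.completeHomogeneous (((lam j : ℕ) : ℤ) - ((j : ℕ) : ℤ) + ((i : ℕ) : ℤ)) i
          (RowBound.core (RowBound.columnLengths lam hlam) β j)) :=
  corollary5p3_general subset_rfl hβ
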